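/- **Setting.** Let $\mathbb K$ be $\mathbb R$ or $\mathbb C$. Let $C_{-1}(0,+\infty)$ be the space of functions $f$ on $(0,\infty)$ with values in $\mathbb K$ of the form $f(t)=t^{p}f_1(t)$, $t>0$, with $p>-1$ and $f_1\in C[0,+\infty)$. With the Laplace convolution $(f*g)(t)=\int_0^t f(t-\tau)g(\tau)\,d\tau$ it is a commutative ring $\mathcal R_{-1}$ without divisors of zero. Let $\mathcal F_{-1}$ be its field of convolution quotients: the classes $\frac fg$ of pairs $(f,g)$ with $f,g\in C_{-1}(0,+\infty)$, $g\neq 0$, where $(f_1,g_1)\sim(f_2,g_2)$ if and only if $f_1*g_2=f_2*g_1$, with the operations $\frac{f_1}{g_1}+\frac{f_2}{g_2}=\frac{f_1*g_2+f_2*g_1}{g_1*g_2}$, $\frac{f_1}{g_1}\cdot\frac{f_2}{g_2}=\frac{f_1*f_2}{g_1*g_2}$ and the scalar multiplication $\lambda\frac fg=\frac{\lambda f}{g}$. Let $\kappa,k_1,k_2\in C_{-1}(0,+\infty)$ satisfy $(\kappa*k_1*k_2)(t)=1$ for all $t>0$. A function $f\in C_{-1}(0,+\infty)$ is identified with the element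 $\frac{f*\kappa}{\kappa}$ of $\mathcal F_{-1}$, and $S_\kappa:=\frac{\kappa}{\kappa^{<2>}}$, where $\kappa^{<2>}=\kappa*\kappa$; it is the inverse of $\kappa$ in $\mathcal F_{-1}$. Write $\mathbb I_{(k)}f=k*f$. Let $C^1_{-1,(k_2)}(0,+\infty)$ be the set of $f\in C_{-1}(0,+\infty)$ such that $\mathbb I_{(k_2)}f$ is differentiable on $(0,\infty)$ and $\frac{d}{dt}\mathbb I_{(k_2)}f\in C_{-1}(0,+\infty)$. The 1st level general fractional derivative (GFD) of $f$ is $${}_{1L}\mathbb D_{(k_1,k_2)}f=\mathbb I_{(k_1)}\,\frac{d}{dt}\,\mathbb I_{(k_2)}f .$$ Let $(\mathbb I_{(k_2)}f)(0):=\lim_{t\to0+}(\mathbb I_{(k_2)}f)(t)$. The 1st level algebraic GFD of $f$ is the element $S_\kappa\cdot f-S_\kappa\cdot P_{1L}f$ of $\mathcal F_{-1}$, where $P_{1L}f=(\mathbb I_{(k_2)}f)(0)\,(\kappa*k_1)$. **Theorem.** Let $f\in C^1_{-1,(k_2)}(0,+\infty)$. Then: 1. the 1st level GFD $({}_{1L}\mathbb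 D_{(k_1,k_2)}f)(t)$ exists in the usual sense for every $t>0$ (both integrals converge and the derivative exists), and ${}_{1L}\mathbb D_{(k_1,k_2)}f\in C_{-1}(0,+\infty)$; 2. the limit $(\mathbb I_{(k_2)}f)(0)$ exists, so that the 1st level algebraic GFD of $f$ is defined, and $P_{1L}f=f-\mathbb I_{(\kappa)}\,{}_{1L}\mathbb D_{(k_1,k_2)}f$ on $(0,\infty)$; 3. the 1st level GFD coincides in $\mathcal F_{-1}$ with the 1st level algebraic GFD: $${}_{1L}\mathbb D_{(k_1,k_2)}f \;=\; S_\kappa\cdot f-S_\kappa\cdot P_{1L}f\;=\;S_\kappa\cdot f-(\mathbb I_{(k_2)}f)(0)\,k_1 ,$$ where all functions are interpreted as elements of $\mathcal F_{-1}$. -/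

import Mathlib

open Set Filter Topology MeasureTheory

namespace GFDCalculus

noncomputable section

variable {𝕜 : Type*} [RCLike 𝕜]

/-- The space `C₋₁(0,∞)`: functions with `f(t) = t ^ p · f₁(t)` for `t > 0`, where `p > -1` and
`f₁ ∈ C[0,∞)`. Only the values of `f` on `(0,∞)` matter. -/
def MemCm1 (f : ℝ → 𝕜) : Prop :=
  ∃ p : ℝ, -1 < p ∧ ∃ f₁ : ℝ → 𝕜, ContinuousOn f₁ (Ici 0) ∧ ∀ t : ℝ, 0 < t → f t = (t ^ p) • f₁ t

/-- The Laplace convolution `(f * g)(t) = ∫₀ᵗ f(t - τ) g(τ) dτ`. -/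
def lconv (f g : ℝ → 𝕜) (t : ℝ) : 𝕜 := ∫ τ in (0 : ℝ)..t, f (t - τ) * g τ

theorem MemCm1.exists_continuous {f : ℝ → 𝕜} (hf : MemCm1 f) :
    ∃ p : ℝ, -1 < p ∧ ∃ f₁ : ℝ → 𝕜, Continuous f₁ ∧ ∀ t : ℝ, 0 < t → f t = (t ^ p) • f₁ t := by
  obtain ⟨p, hp, f₁, hf₁, h⟩ := hf
  refine ⟨p, hp, fun t => f₁ (max t 0), ?_, fun t ht => by
    simp only [max_eq_left ht.le, h t ht]⟩
  exact hf₁.comp_continuous (by fun_prop) fun t => le_max_right t 0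

theorem MemCm1.continuousOn {f : ℝ → 𝕜} (hf : MemCm1 f) : ContinuousOn f (Ioi 0) := by
  obtain ⟨p, hp, f₁, hf₁, h⟩ := hf
  refine ContinuousOn.congr (f := fun t : ℝ => (t ^ p) • f₁ t) ?_ fun t ht => h t ht
  refine ContinuousOn.smul (fun t ht => ?_) (hf₁.mono Ioi_subset_Ici_self)
  exact (Real.continuousAt_rpow_const t p (Or.inl (ne_of_gt ht))).continuousWithinAt

theorem intervalIntegrable_beta {p q : ℝ} (hp : -1 < p) (hq : -1 < q) :
    IntervalIntegrable (fun s : ℝ => (1 - s) ^ p * s ^ q) volume 0 1 := by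
  have h := (Complex.betaIntegral_convergent (u := ((q + 1 : ℝ) : ℂ)) (v := ((p + 1 : ℝ) : ℂ))
    (by simpa using by linarith) (by simpa using by linarith)).norm
  refine h.congr_uIoo ?_
  intro x hx
  rw [uIoo_of_le zero_le_one] at hx
  have h1 : (1 - (x : ℂ)) = ((1 - x : ℝ) : ℂ) := by push_cast; ring
  have e1 : (((q + 1 : ℝ) : ℂ) - 1) = ((q : ℝ) : ℂ) := by push_cast; ring
  have e2 : (((p + 1 : ℝ) : ℂ) - 1) = ((p : ℝ) : ℂ) := by push_cast; ring
  simp only [norm_mul]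
  rw [h1, e1, e2, Complex.norm_cpow_eq_rpow_re_of_pos hx.1,
    Complex.norm_cpow_eq_rpow_re_of_pos (sub_pos.2 hx.2), Complex.ofReal_re, Complex.ofReal_re,
    mul_comm]

theorem rep_integrable {p q : ℝ} (hp : -1 < p) (hq : -1 < q) {φ : ℝ → 𝕜} (hφ : Continuous φ) :
    IntervalIntegrable (fun s : ℝ => ((1 - s) ^ p * s ^ q) • φ s) volume 0 1 :=
  (intervalIntegrable_beta hp hq).smul_continuousOn hφ.continuousOn

theorem lconv_integrable {f g : ℝ → 𝕜} (hf : MemCm1 f) (hg : MemCm1 g) {t : ℝ} (ht : 0 < t) :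
    IntervalIntegrable (fun τ => f (t - τ) * g τ) volume 0 t := by
  obtain ⟨p, hp, f₁, hf₁, h⟩ := hf.exists_continuous
  obtain ⟨q, hq, g₁, hg₁, h'⟩ := hg.exists_continuous
  have h1 := (rep_integrable (𝕜 := 𝕜) hp hq (φ := fun s => f₁ (t - t * s) * g₁ (t * s))
    (by fun_prop)).const_mul (((t ^ p * t ^ q : ℝ) : 𝕜))
  have h2 := h1.comp_mul_left (c := t⁻¹)
  simp only [zero_div, one_div, inv_inv] at h2
  refine h2.congr_uIoo ?_
  intro τ hτ
  rw [uIoo_of_le ht.le] at hτ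
  have e : t * (t⁻¹ * τ) = τ := by field_simp
  have e2 : (1 - t⁻¹ * τ) = (t - τ) / t := by field_simp
  have e3 : t⁻¹ * τ = τ / t := by field_simp
  simp only
  rw [e, h _ (sub_pos.2 hτ.2), h' _ hτ.1, e2, e3, Real.div_rpow (sub_pos.2 hτ.2).le ht.le,
    Real.div_rpow hτ.1.le ht.le]
  simp only [RCLike.real_smul_eq_coe_mul]
  have a1 : ((t ^ p : ℝ) : 𝕜) ≠ 0 := by simpa using (Real.rpow_pos_of_pos ht p).ne'
  have a2 : ((t ^ q : ℝ) : 𝕜) ≠ 0 := by simpa using (Real.rpow_pos_of_pos ht q).ne'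
  push_cast
  field_simp

theorem lconv_rep {f g f₁ g₁ : ℝ → 𝕜} {p q : ℝ} (h : ∀ t : ℝ, 0 < t → f t = (t ^ p) • f₁ t)
    (h' : ∀ t : ℝ, 0 < t → g t = (t ^ q) • g₁ t) {t : ℝ} (ht : 0 < t) :
    lconv f g t = (t ^ (p + q + 1)) •
      ∫ s in (0 : ℝ)..1, ((1 - s) ^ p * s ^ q) • (f₁ (t - t * s) * g₁ (t * s)) := by
  have h1 := intervalIntegral.smul_integral_comp_mul_left (a := 0) (b := 1)
    (fun τ => f (t - τ) * g τ) t
  rw [mul_zero, mul_one] at h1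
  rw [lconv, ← h1, Real.rpow_add ht, Real.rpow_add ht, Real.rpow_one, mul_comm, mul_smul]
  congr 1
  rw [← intervalIntegral.integral_smul]
  refine intervalIntegral.integral_congr_Ioo_of_le zero_le_one fun s hs => ?_
  have e2 : t - t * s = t * (1 - s) := by ring
  have b1 : 0 < 1 - s := sub_pos.2 hs.2
  rw [h' _ (mul_pos ht hs.1), h _ (by rw [e2]; positivity)]
  rw [e2, Real.mul_rpow ht.le b1.le, Real.mul_rpow ht.le hs.1.le]
  simp only [RCLike.real_smul_eq_coe_mul]
  push_cast
  ring

theorem MemCm1.lconv {f g : ℝ → 𝕜} (hf : MemCm1 f) (hg : MemCm1 g) : MemCm1 (lconv f g) := by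
  obtain ⟨p, hp, f₁, hf₁, h⟩ := hf.exists_continuous
  obtain ⟨q, hq, g₁, hg₁, h'⟩ := hg.exists_continuous
  refine ⟨p + q + 1, by linarith, _, Continuous.continuousOn ?_, fun t ht => lconv_rep h h' ht⟩
  rw [continuous_iff_continuousAt]
  intro t₀
  have hc : Continuous (fun x : ℝ × ℝ => f₁ (x.1 - x.1 * x.2) * g₁ (x.1 * x.2)) := by fun_prop
  obtain ⟨C, hC⟩ := (isCompact_Icc (a := t₀ - 1) (b := t₀ + 1)).prod
    (isCompact_Icc (a := (0 : ℝ)) (b := 1)) |>.exists_bound_of_continuousOn hc.continuousOn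
  refine intervalIntegral.continuousAt_of_dominated_interval
    (bound := fun s => ‖(1 - s) ^ p * s ^ q‖ * C) ?_ ?_ ?_ ?_
  · refine Eventually.of_forall fun t => ?_
    exact ((rep_integrable hp hq (φ := fun s => f₁ (t - t * s) * g₁ (t * s))
      (by fun_prop)).def').aestronglyMeasurable
  · filter_upwards [Icc_mem_nhds (show t₀ - 1 < t₀ by linarith) (show t₀ < t₀ + 1 by linarith)]
      with t ht
    refine Eventually.of_forall fun s hs => ?_
    rw [uIoc_of_le zero_le_one] at hs
    rw [norm_smul]
    exact mul_le_mul_of_nonneg_left (hC (t, s) ⟨ht, hs.1.le, hs.2⟩) (norm_nonneg _)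
  · exact (intervalIntegrable_beta hp hq).norm.mul_const C
  · refine Eventually.of_forall fun s _ => ?_
    fun_prop

theorem MemCm1.zero : MemCm1 (0 : ℝ → 𝕜) :=
  ⟨0, by norm_num, 0, continuousOn_const, fun t _ => by simp⟩

theorem MemCm1.one : MemCm1 (fun _ => 1 : ℝ → 𝕜) :=
  ⟨0, by norm_num, fun _ => 1, continuousOn_const, fun t _ => by simp⟩

theorem MemCm1.smul (c : 𝕜) {f : ℝ → 𝕜} (hf : MemCm1 f) : MemCm1 (c • f) := by
  obtain ⟨p, hp, f₁, hf₁, h⟩ := hf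
  refine ⟨p, hp, c • f₁, hf₁.const_smul c, fun t ht => ?_⟩
  rw [Pi.smul_apply, Pi.smul_apply, h t ht, smul_comm]

theorem MemCm1.rebase {f : ℝ → 𝕜} {p r : ℝ} (hr : r ≤ p) {f₁ : ℝ → 𝕜} (hf₁ : ContinuousOn f₁ (Ici 0))
    (h : ∀ t : ℝ, 0 < t → f t = (t ^ p) • f₁ t) :
    ∃ f₂ : ℝ → 𝕜, ContinuousOn f₂ (Ici 0) ∧ ∀ t : ℝ, 0 < t → f t = (t ^ r) • f₂ t := by
  refine ⟨fun t => (t ^ (p - r)) • f₁ t, ?_, fun t ht => ?_⟩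
  · exact (Real.continuous_rpow_const (sub_nonneg.2 hr)).continuousOn.smul hf₁
  · rw [h t ht, smul_smul, ← Real.rpow_add ht]; congr 2; ring

theorem MemCm1.add {f g : ℝ → 𝕜} (hf : MemCm1 f) (hg : MemCm1 g) : MemCm1 (f + g) := by
  obtain ⟨p, hp, f₁, hf₁, h⟩ := hf
  obtain ⟨q, hq, g₁, hg₁, h'⟩ := hg
  obtain ⟨f₂, hf₂, h₂⟩ := MemCm1.rebase (min_le_left p q) hf₁ h
  obtain ⟨g₂, hg₂, h₂'⟩ := MemCm1.rebase (min_le_right p q) hg₁ h'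
  refine ⟨min p q, lt_min hp hq, f₂ + g₂, hf₂.add hg₂, fun t ht => ?_⟩
  rw [Pi.add_apply, Pi.add_apply, h₂ t ht, h₂' t ht, smul_add]

theorem MemCm1.congr {f g : ℝ → 𝕜} (hf : MemCm1 f) (h : ∀ t, 0 < t → g t = f t) : MemCm1 g := by
  obtain ⟨p, hp, f₁, hf₁, h'⟩ := hf
  exact ⟨p, hp, f₁, hf₁, fun t ht => by rw [h t ht, h' t ht]⟩

theorem MemCm1.mul_id {f : ℝ → 𝕜} (hf : MemCm1 f) : MemCm1 (fun t => (t : 𝕜) * f t) := by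
  obtain ⟨p, hp, f₁, hf₁, h⟩ := hf
  refine ⟨p + 1, by linarith, f₁, hf₁, fun t ht => ?_⟩
  simp only [h t ht, Real.rpow_add_one ht.ne', RCLike.real_smul_eq_coe_mul]
  push_cast
  ring

theorem MemCm1.norm {f : ℝ → 𝕜} (hf : MemCm1 f) : MemCm1 (fun t => ‖f t‖) := by
  obtain ⟨p, hp, f₁, hf₁, h⟩ := hf
  refine ⟨p, hp, fun t => ‖f₁ t‖, hf₁.norm, fun t ht => ?_⟩
  simp only [h t ht, norm_smul, Real.norm_of_nonneg (Real.rpow_nonneg ht.le p), smul_eq_mul]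

theorem lconv_comm (f g : ℝ → 𝕜) : lconv f g = lconv g f := by
  funext t
  have h := intervalIntegral.integral_comp_sub_left (a := 0) (b := t) (fun τ => f τ * g (t - τ)) t
  simp only [sub_sub_cancel, sub_self, sub_zero] at h
  rw [lconv, h, lconv]
  simp only [mul_comm]

theorem lconv_congr {f g f' g' : ℝ → 𝕜} (hf : ∀ t, 0 < t → f t = f' t) (hg : ∀ t, 0 < t → g t = g' t)
    {t : ℝ} (ht : 0 < t) : lconv f g t = lconv f' g' t := by
  refine intervalIntegral.integral_congr_Ioo_of_le ht.le fun τ hτ => ?_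
  rw [hf _ (sub_pos.2 hτ.2), hg _ hτ.1]

theorem lconv_eq_convolution {f g : ℝ → 𝕜} {t : ℝ} (ht : 0 < t) :
    lconv f g t = convolution (indicator (Ioi 0) g) (indicator (Ioi 0) f)
      (ContinuousLinearMap.mul ℝ 𝕜) volume t := by
  rw [← posConvolution_eq_convolution_indicator g f (ContinuousLinearMap.mul ℝ 𝕜) volume,
    posConvolution, indicator_of_mem (by exact ht), lconv]
  simp [mul_comm]

theorem convolution_indicator_zero {f g : ℝ → 𝕜} {t : ℝ} (ht : t ≤ 0) :
    convolution (indicator (Ioi 0) g) (indicator (Ioi 0) f)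
      (ContinuousLinearMap.mul ℝ 𝕜) volume t = 0 := by
  rw [← posConvolution_eq_convolution_indicator g f (ContinuousLinearMap.mul ℝ 𝕜) volume,
    posConvolution,
    indicator_of_notMem (by simpa using ht)]

theorem convolution_eq_indicator {f g : ℝ → 𝕜} :
    convolution (indicator (Ioi 0) g) (indicator (Ioi 0) f)
      (ContinuousLinearMap.mul ℝ 𝕜) volume = indicator (Ioi 0) (lconv f g) := by
  funext t
  by_cases ht : 0 < t
  · rw [indicator_of_mem (by exact ht), lconv_eq_convolution ht]
  · rw [indicator_of_notMem (by simpa using ht), convolution_indicator_zero (not_lt.1 ht)]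

theorem convolutionExistsAt {f g : ℝ → 𝕜} (hf : MemCm1 f) (hg : MemCm1 g) (t : ℝ) :
    ConvolutionExistsAt (indicator (Ioi 0) g) (indicator (Ioi 0) f) t
      (ContinuousLinearMap.mul ℝ 𝕜) volume := by
  rw [ConvolutionExistsAt]
  have key : (fun τ => (ContinuousLinearMap.mul ℝ 𝕜) (indicator (Ioi 0) g τ)
      (indicator (Ioi 0) f (t - τ))) = indicator (Ioo 0 t) fun τ => f (t - τ) * g τ := by
    funext τ
    by_cases h1 : 0 < τ
    · by_cases h2 : τ < t
      · rw [indicator_of_mem (by exact h1), indicator_of_mem (by simpa using h2),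
          indicator_of_mem (show τ ∈ Ioo 0 t from ⟨h1, h2⟩), ContinuousLinearMap.mul_apply', mul_comm]
      · rw [indicator_of_notMem (show t - τ ∉ Ioi 0 by simpa using h2),
          map_zero, indicator_of_notMem (show τ ∉ Ioo 0 t from fun h => h2 h.2)]
    · rw [indicator_of_notMem (show τ ∉ Ioi 0 by simpa using h1),
        map_zero, zero_apply,
        indicator_of_notMem (show τ ∉ Ioo 0 t from fun h => h1 h.1)]
  rw [key, integrable_indicator_iff measurableSet_Ioo]
  rcases le_or_gt t 0 with ht | ht
  · rw [Ioo_eq_empty (not_lt.2 ht)]; exact integrableOn_empty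
  · exact ((intervalIntegrable_iff_integrableOn_Ioo_of_le ht.le).1 (lconv_integrable hf hg ht))

theorem MemCm1.aestronglyMeasurable {f : ℝ → 𝕜} (hf : MemCm1 f) :
    AEStronglyMeasurable (indicator (Ioi 0) f) volume :=
  (aestronglyMeasurable_indicator_iff measurableSet_Ioi).2
    (hf.continuousOn.aestronglyMeasurable measurableSet_Ioi)

theorem lconv_assoc {f g h : ℝ → 𝕜} (hf : MemCm1 f) (hg : MemCm1 g) (hh : MemCm1 h) {t : ℝ}
    (ht : 0 < t) : lconv (lconv f g) h t = lconv f (lconv g h) t := by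
  have e : ∀ k : ℝ → 𝕜, (fun x => ‖indicator (Ioi 0) k x‖) = indicator (Ioi 0) fun x => ‖k x‖ := by
    intro k; funext x; exact norm_indicator_eq_indicator_norm k x
  have key := convolution_assoc (L := ContinuousLinearMap.mul ℝ 𝕜) (L₂ := ContinuousLinearMap.mul ℝ 𝕜)
    (L₃ := ContinuousLinearMap.mul ℝ 𝕜) (L₄ := ContinuousLinearMap.mul ℝ 𝕜)
    (f := indicator (Ioi 0) h) (g := indicator (Ioi 0) g) (k := indicator (Ioi 0) f)
    (μ := volume) (ν := volume) (x₀ := t) (fun x y z => by simp [mul_assoc])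
    hh.aestronglyMeasurable hg.aestronglyMeasurable hf.aestronglyMeasurable
    (Eventually.of_forall fun y => convolutionExistsAt hg hh y)
    (Eventually.of_forall fun y => by
      rw [e, e]; exact convolutionExistsAt hf.norm hg.norm y)
    (by
      rw [e, e, e]
      have := convolution_eq_indicator (f := fun x => ‖f x‖) (g := fun x => ‖g x‖)
      rw [this]
      exact convolutionExistsAt (hf.norm.lconv hg.norm) hh.norm t)
  rw [convolution_eq_indicator, convolution_eq_indicator, convolution_eq_indicator,
    convolution_eq_indicator, indicator_of_mem (by exact ht), indicator_of_mem (by exact ht)] at key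
  exact key.symm

/-- A function on `(0, a)` all of whose moments vanish is zero. -/
theorem moments_zero {a : ℝ} (ha : 0 < a) {u : ℝ → 𝕜} (hu : IntervalIntegrable u volume 0 a)
    (hc : ContinuousOn u (Ioo 0 a)) (hm : ∀ n : ℕ, ∫ x in (0 : ℝ)..a, ((x ^ n : ℝ) : 𝕜) * u x = 0) :
    ∀ x ∈ Ioo 0 a, u x = 0 := by
  have hpoly : ∀ P : Polynomial ℝ, ∫ x in (0 : ℝ)..a, (P.eval x : ℝ) • u x = 0 := by
    intro P
    have e : ∀ x : ℝ, (P.eval x : ℝ) • u x =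
        ∑ i ∈ Finset.range (P.natDegree + 1), ((P.coeff i : ℝ) : 𝕜) * (((x ^ i : ℝ) : 𝕜) * u x) := by
      intro x
      rw [Polynomial.eval_eq_sum_range, RCLike.real_smul_eq_coe_mul]
      push_cast
      rw [Finset.sum_mul]
      exact Finset.sum_congr rfl fun i _ => by ring
    simp_rw [e]
    rw [intervalIntegral.integral_finsetSum]
    · exact Finset.sum_eq_zero fun i _ => by rw [intervalIntegral.integral_const_mul, hm, mul_zero]
    · intro i _
      refine (hu.continuousOn_mul ?_).const_mul _
      exact Continuous.continuousOn (by fun_prop)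
  have hcont : ∀ φ : ℝ → ℝ, Continuous φ → ∫ x in (0 : ℝ)..a, φ x • u x = 0 := by
    intro φ hφ
    rw [← norm_le_zero_iff]
    refine le_of_forall_pos_le_add fun ε hε => ?_
    rw [zero_add]
    set K := ∫ x in (0 : ℝ)..a, ‖u x‖ with hK
    have hK0 : 0 ≤ K := intervalIntegral.integral_nonneg ha.le fun _ _ => norm_nonneg _
    obtain ⟨P, hP⟩ := exists_polynomial_near_of_continuousOn 0 a φ hφ.continuousOn (ε / (K + 1))
      (by positivity)
    have h1 : IntervalIntegrable (fun x => φ x • u x) volume 0 a :=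
      hu.continuousOn_smul hφ.continuousOn
    have h2 : IntervalIntegrable (fun x => (P.eval x : ℝ) • u x) volume 0 a :=
      hu.continuousOn_smul P.continuous.continuousOn
    have h3 : ∫ x in (0 : ℝ)..a, φ x • u x = ∫ x in (0 : ℝ)..a, (φ x - P.eval x) • u x := by
      simp_rw [sub_smul]
      rw [intervalIntegral.integral_sub h1 h2, hpoly, sub_zero]
    rw [h3]
    calc ‖∫ x in (0 : ℝ)..a, (φ x - P.eval x) • u x‖
        ≤ ∫ x in (0 : ℝ)..a, (ε / (K + 1)) * ‖u x‖ := by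
          refine intervalIntegral.norm_integral_le_of_norm_le ha.le ?_ (hu.norm.const_mul _)
          refine Eventually.of_forall fun x hx => ?_
          rw [norm_smul]
          refine mul_le_mul_of_nonneg_right ?_ (norm_nonneg _)
          rw [Real.norm_eq_abs, abs_sub_comm]
          exact (hP x ⟨hx.1.le, hx.2⟩).le
      _ = (ε / (K + 1)) * K := by rw [intervalIntegral.integral_const_mul]
      _ ≤ ε := by
          rw [div_mul_eq_mul_div, div_le_iff₀ (by positivity)]
          nlinarith
  have hae := IsOpen.ae_eq_zero_of_integral_contDiff_smul_eq_zero (μ := volume) (f := u)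
    (isOpen_Ioo (a := (0 : ℝ)) (b := a))
    (((intervalIntegrable_iff_integrableOn_Ioo_of_le ha.le).1 hu).locallyIntegrableOn)
    (fun g hg _ hs => by
      have h := hcont g hg.continuous
      rw [intervalIntegral.integral_of_le ha.le, integral_Ioc_eq_integral_Ioo] at h
      rw [← h]
      refine (setIntegral_eq_integral_of_forall_compl_eq_zero fun x hx => ?_).symm
      rw [image_eq_zero_of_notMem_tsupport fun h' => hx (hs h'), zero_smul])
  have hae' : u =ᵐ[volume.restrict (Ioo 0 a)] fun _ => 0 :=
    (ae_restrict_iff' measurableSet_Ioo).2 hae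
  exact Measure.eqOn_open_of_ae_eq hae' isOpen_Ioo hc continuousOn_const

/-- If the exponential integrals of `h` stay bounded along the positive half-axis, then all moments
of `h` vanish. -/
theorem moments_of_bounded {a : ℝ} (ha : 0 < a) {h : ℝ → ℂ} (hh : IntervalIntegrable h volume 0 a)
    {M : ℝ} (hM : ∀ x : ℝ, 0 ≤ x → ‖∫ u in (0 : ℝ)..a, Complex.exp (x * u) * h u‖ ≤ M) (n : ℕ) :
    ∫ u in (0 : ℝ)..a, ((u ^ n : ℝ) : ℂ) * h u = 0 := by
  let G : (ℝ → ℂ) → ℂ → ℂ := fun k z => ∫ u in (0 : ℝ)..a, Complex.exp (z * u) * k u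
  have hint : ∀ k : ℝ → ℂ, IntervalIntegrable k volume 0 a → ∀ z : ℂ,
      IntervalIntegrable (fun u : ℝ => Complex.exp (z * u) * k u) volume 0 a := fun k hk z =>
    hk.continuousOn_mul (Continuous.continuousOn (by fun_prop))
  have hder : ∀ k : ℝ → ℂ, IntervalIntegrable k volume 0 a → ∀ z : ℂ,
      HasDerivAt (G k) (G (fun u => (u : ℂ) * k u) z) z := by
    intro k hk z
    have hk' : IntervalIntegrable (fun u : ℝ => (u : ℂ) * k u) volume 0 a :=
      hk.continuousOn_mul (Continuous.continuousOn (by fun_prop))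
    refine (intervalIntegral.hasDerivAt_integral_of_dominated_loc_of_deriv_le
      (s := Metric.ball z 1)
      (F := fun w (u : ℝ) => Complex.exp (w * u) * k u)
      (F' := fun w (u : ℝ) => Complex.exp (w * u) * ((u : ℂ) * k u))
      (bound := fun u => Real.exp ((‖z‖ + 1) * a) * ‖(u : ℂ) * k u‖)
      (Metric.ball_mem_nhds z one_pos) ?_ (hint k hk z) ?_ ?_ ?_ ?_).2
    · exact Eventually.of_forall fun w => (hint k hk w).def'.aestronglyMeasurable
    · exact (hint _ hk' z).def'.aestronglyMeasurable
    · refine Eventually.of_forall fun u hu w hw => ?_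
      rw [uIoc_of_le ha.le] at hu
      rw [norm_mul]
      refine mul_le_mul_of_nonneg_right ?_ (norm_nonneg _)
      refine (Complex.norm_exp_le_exp_norm _).trans (Real.exp_le_exp.2 ?_)
      rw [norm_mul, Complex.norm_real, Real.norm_of_nonneg hu.1.le]
      have : ‖w‖ ≤ ‖z‖ + 1 := by
        have h1 := norm_sub_norm_le w z
        have h2 : ‖w - z‖ < 1 := by simpa [dist_eq_norm] using hw
        linarith
      exact mul_le_mul this hu.2 hu.1.le (by positivity)
    · exact hk'.norm.const_mul _
    · refine Eventually.of_forall fun u _ w _ => ?_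
      have h1 : HasDerivAt (fun w : ℂ => w * (u : ℂ)) (u : ℂ) w := by
        simpa using (hasDerivAt_id w).mul_const (u : ℂ)
      have h2 := (h1.cexp).mul_const (k u)
      rwa [mul_assoc] at h2
  set C := ∫ u in (0 : ℝ)..a, ‖h u‖ with hC
  have hdiff : Differentiable ℂ (G h) := fun z => (hder h hh z).differentiableAt
  have hbd : ∀ z : ℂ, ‖G h z‖ ≤ Real.exp (max z.re 0 * a) * C := by
    intro z
    rw [hC, ← intervalIntegral.integral_const_mul]
    refine intervalIntegral.norm_integral_le_of_norm_le ha.le ?_ (hh.norm.const_mul _)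
    refine Eventually.of_forall fun u hu => ?_
    rw [norm_mul]
    refine mul_le_mul_of_nonneg_right ?_ (norm_nonneg _)
    rw [Complex.norm_exp]
    refine Real.exp_le_exp.2 ?_
    simp only [Complex.mul_re, Complex.ofReal_re, Complex.ofReal_im, mul_zero, sub_zero]
    exact (mul_le_mul_of_nonneg_right (le_max_left _ _) hu.1.le).trans
      (mul_le_mul_of_nonneg_left hu.2 (le_max_right _ _))
  have hleft : ∀ z : ℂ, z.re ≤ 0 → ‖G h z‖ ≤ C := by
    intro z hz
    simpa [max_eq_right hz] using hbd z
  have hright : ∀ z : ℂ, 0 ≤ z.re → ‖G h z‖ ≤ C := by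
    intro z hz
    refine PhragmenLindelof.right_half_plane_of_bounded_on_real (f := G h) hdiff.diffContOnCl
      ⟨1, by norm_num, a, ?_⟩ ?_ ?_ hz
    · refine Asymptotics.IsBigO.of_bound C (Eventually.of_forall fun z => ?_)
      rw [Real.norm_of_nonneg (Real.exp_pos _).le, Real.rpow_one, mul_comm C]
      refine (hbd z).trans (mul_le_mul_of_nonneg_right (Real.exp_le_exp.2 ?_) ?_)
      · rw [mul_comm]
        exact mul_le_mul_of_nonneg_left
          (max_le ((le_abs_self _).trans (Complex.abs_re_le_norm z)) (norm_nonneg _)) ha.le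
      · exact intervalIntegral.integral_nonneg ha.le fun _ _ => norm_nonneg _
    · refine isBoundedUnder_of_eventually_le (a := M) ?_
      filter_upwards [eventually_ge_atTop 0] with x hx
      exact hM x hx
    · intro x
      exact hleft _ (by simp)
  have hbdd : Bornology.IsBounded (range (G h)) := by
    refine isBounded_iff_forall_norm_le.2 ⟨C, ?_⟩
    rintro _ ⟨z, rfl⟩
    rcases le_total z.re 0 with hz | hz
    exacts [hleft z hz, hright z hz]
  have hconst : ∀ z w, G h z = G h w := fun z w => hdiff.apply_eq_apply_of_bounded hbdd z w
  have hlim : Tendsto (fun x : ℝ => G h (-(x : ℂ))) atTop (𝓝 0) := by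
    have h0 : (0 : ℂ) = ∫ u in (0 : ℝ)..a, (0 : ℂ) := by simp
    rw [h0]
    refine intervalIntegral.tendsto_integral_filter_of_dominated_convergence (fun u => ‖h u‖)
      ?_ ?_ hh.norm ?_
    · exact Eventually.of_forall fun x => (hint h hh _).def'.aestronglyMeasurable
    · filter_upwards [eventually_ge_atTop 0] with x hx
      refine Eventually.of_forall fun u hu => ?_
      rw [uIoc_of_le ha.le] at hu
      rw [norm_mul, Complex.norm_exp]
      refine mul_le_of_le_one_left (norm_nonneg _) (Real.exp_le_one_iff.2 ?_)
      simp only [Complex.mul_re, Complex.ofReal_re, Complex.ofReal_im, mul_zero, sub_zero,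
        Complex.neg_re]
      nlinarith [hu.1]
    · refine Eventually.of_forall fun u hu => ?_
      rw [uIoc_of_le ha.le] at hu
      rw [← zero_mul (h u)]
      refine Tendsto.mul_const _ ?_
      rw [tendsto_zero_iff_norm_tendsto_zero]
      simp only [Complex.norm_exp, Complex.mul_re, Complex.ofReal_re, Complex.ofReal_im, mul_zero,
        sub_zero, Complex.neg_re]
      refine Real.tendsto_exp_atBot.comp ?_
      exact (tendsto_neg_atTop_atBot).atBot_mul_const hu.1
  have hzero : ∀ z, G h z = 0 := fun z => by
    have h1 : (fun x : ℝ => G h (-(x : ℂ))) = fun _ => G h z := funext fun x => hconst _ _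
    rw [h1] at hlim
    exact tendsto_nhds_unique tendsto_const_nhds hlim
  have hall : ∀ n : ℕ, ∀ z, G (fun u => ((u ^ n : ℝ) : ℂ) * h u) z = 0 := by
    intro n
    induction n with
    | zero => simpa using hzero
    | succ n ih =>
      intro z
      have hk : IntervalIntegrable (fun u : ℝ => ((u ^ n : ℝ) : ℂ) * h u) volume 0 a :=
        hh.continuousOn_mul (Continuous.continuousOn (by fun_prop))
      have h1 := hder _ hk z
      have h2 : G (fun u => ((u ^ n : ℝ) : ℂ) * h u) = fun _ => 0 := funext ih
      rw [h2] at h1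
      have h3 := h1.unique (hasDerivAt_const z 0)
      rw [← h3]
      congr 1
      funext u
      push_cast
      ring
  simpa [G] using hall n 0

theorem MemCm1.intervalIntegrable {f : ℝ → 𝕜} (hf : MemCm1 f) {t : ℝ} (ht : 0 < t) :
    IntervalIntegrable f volume 0 t := by
  simpa using lconv_integrable MemCm1.one hf ht

/-- `f * f = 0` only for `f = 0`. -/
theorem lconv_self_eq_zero {f : ℝ → ℂ} (hf : MemCm1 f) (h : ∀ t, 0 < t → lconv f f t = 0) :
    ∀ t, 0 < t → f t = 0 := by
  intro t₀ ht₀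
  set a := 2 * t₀ with ha'
  set T := 2 * a with hT'
  have ha : 0 < a := by positivity
  have hT : 0 < T := by positivity
  have hTi := hf.intervalIntegrable hT
  set fT := indicator (Ioo 0 T) f with hfT
  have hfTi : Integrable fT :=
    (integrable_indicator_iff measurableSet_Ioo).2
      ((intervalIntegrable_iff_integrableOn_Ioo_of_le hT.le).1 hTi)
  let L := ContinuousLinearMap.mul ℝ ℂ
  let E : ℝ → ℝ → ℂ := fun x t => Complex.exp (x * (a - t))
  have hE : ∀ x, Continuous (E x) := fun x => by fun_prop
  set c := convolution fT fT L volume with hc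
  have hci : Integrable c := hfTi.integrable_convolution L hfTi
  have hc0 : ∀ t, t < T → c t = 0 := by
    intro t ht
    have e : fT = indicator (Ioi 0) fT := by
      funext s
      by_cases hs : 0 < s
      · rw [indicator_of_mem (by exact hs)]
      · rw [indicator_of_notMem (by exact hs), hfT, indicator_of_notMem (fun h => hs h.1)]
    rw [hc, e, convolution_eq_indicator]
    by_cases h0 : 0 < t
    · rw [indicator_of_mem (by exact h0), ← h t h0]
      refine intervalIntegral.integral_congr_Ioo_of_le h0.le fun τ hτ => ?_
      simp only [hfT]
      rw [indicator_of_mem (show t - τ ∈ Ioo 0 T from ⟨by linarith [hτ.2], by linarith [hτ.1]⟩),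
        indicator_of_mem (show τ ∈ Ioo 0 T from ⟨hτ.1, by linarith [hτ.2]⟩)]
    · rw [indicator_of_notMem (by exact h0)]
  have hFe : ∀ x, (fun t => E x t * fT t) = indicator (Ioo 0 T) fun t => E x t * f t := by
    intro x; funext t
    by_cases ht : t ∈ Ioo 0 T
    · rw [indicator_of_mem ht, hfT, indicator_of_mem ht]
    · rw [indicator_of_notMem ht, hfT, indicator_of_notMem ht, mul_zero]
  have hEf : ∀ x u v, IntervalIntegrable f volume u v →
      IntervalIntegrable (fun t => E x t * f t) volume u v := fun x u v hi =>
    hi.continuousOn_mul (hE x).continuousOn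
  have hFi : ∀ x, Integrable fun t => E x t * fT t := by
    intro x
    rw [hFe]
    exact (integrable_indicator_iff measurableSet_Ioo).2
      ((intervalIntegrable_iff_integrableOn_Ioo_of_le hT.le).1 (hEf x 0 T hTi))
  have hA : ∀ x : ℝ, ∫ t, E x t * fT t = ∫ t in (0 : ℝ)..T, E x t * f t := by
    intro x
    rw [hFe, integral_indicator measurableSet_Ioo, intervalIntegral.integral_of_le hT.le,
      integral_Ioc_eq_integral_Ioo]
  have hconv : ∀ x t : ℝ, convolution (fun t => E x t * fT t) (fun t => E x t * fT t) L volume t =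
      Complex.exp (x * (T - t)) * c t := by
    intro x t
    rw [hc, convolution, convolution, ← integral_const_mul]
    refine integral_congr_ae (Eventually.of_forall fun τ => ?_)
    simp only [L, ContinuousLinearMap.mul_apply', E]
    have e : Complex.exp (x * (T - t)) =
        Complex.exp (x * (a - τ)) * Complex.exp (x * (a - ((t - τ : ℝ) : ℂ))) := by
      rw [← Complex.exp_add]; congr 1; rw [hT']; push_cast; ring
    rw [e]; ring
  set K := ∫ t, ‖c t‖ with hK
  have hAK : ∀ x : ℝ, 0 ≤ x → ‖∫ t in (0 : ℝ)..T, E x t * f t‖ ≤ Real.sqrt K := by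
    intro x hx
    refine Real.le_sqrt_of_sq_le ?_
    have h1 := integral_convolution L (hFi x) (hFi x)
    simp only [L, ContinuousLinearMap.mul_apply', hA] at h1
    rw [pow_two, ← norm_mul, ← h1]
    refine (norm_integral_le_integral_norm _).trans (integral_mono_of_nonneg
      (Eventually.of_forall fun _ => norm_nonneg _) hci.norm (Eventually.of_forall fun t => ?_))
    have h2 := hconv x t
    simp only [L] at h2
    simp only [h2]
    rcases lt_or_ge t T with ht | ht
    · rw [hc0 t ht, mul_zero]
    · rw [norm_mul]
      refine mul_le_of_le_one_left (norm_nonneg _) ?_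
      rw [Complex.norm_exp]
      refine Real.exp_le_one_iff.2 ?_
      rw [← Complex.ofReal_sub, ← Complex.ofReal_mul, Complex.ofReal_re]
      exact mul_nonpos_of_nonneg_of_nonpos hx (by linarith)
  have haT : a ≤ T := by linarith
  have hi1 : IntervalIntegrable f volume 0 a := hf.intervalIntegrable ha
  have hi2 : IntervalIntegrable f volume a T := hi1.symm.trans hTi
  have hB : ∀ x : ℝ, 0 ≤ x → ‖∫ u in (0 : ℝ)..a, Complex.exp (x * u) * f (a - u)‖ ≤
      Real.sqrt K + ∫ t in a..T, ‖f t‖ := by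
    intro x hx
    have h1 := intervalIntegral.integral_comp_sub_left (a := 0) (b := a) (fun t => E x t * f t) a
    simp only [sub_self, sub_zero, E] at h1
    have e : ∀ u : ℝ, ((a : ℂ) - ((a - u : ℝ) : ℂ)) = u := fun u => by push_cast; ring
    simp only [e] at h1
    rw [h1]
    have h2 := intervalIntegral.integral_add_adjacent_intervals (hEf x 0 a hi1) (hEf x a T hi2)
    simp only [E] at h2
    rw [eq_sub_of_add_eq h2]
    refine (norm_sub_le _ _).trans (add_le_add (hAK x hx) ?_)
    refine intervalIntegral.norm_integral_le_of_norm_le haT ?_ hi2.norm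
    refine Eventually.of_forall fun t ht => ?_
    rw [norm_mul, Complex.norm_exp]
    refine mul_le_of_le_one_left (norm_nonneg _) (Real.exp_le_one_iff.2 ?_)
    rw [← Complex.ofReal_sub, ← Complex.ofReal_mul, Complex.ofReal_re]
    exact mul_nonpos_of_nonneg_of_nonpos hx (by linarith [ht.1])
  have hgi : IntervalIntegrable (fun u => f (a - u)) volume 0 a := by
    simpa using lconv_integrable hf MemCm1.one ha
  have hres := moments_zero ha hgi (hf.continuousOn.comp (by fun_prop)
    fun u hu => sub_pos.2 hu.2) (fun n => moments_of_bounded ha hgi hB n) t₀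
    ⟨ht₀, by linarith⟩
  have e : a - t₀ = t₀ := by rw [ha']; ring
  rwa [e] at hres

theorem lconv_add {f g h : ℝ → 𝕜} (hf : MemCm1 f) (hg : MemCm1 g) (hh : MemCm1 h) {t : ℝ}
    (ht : 0 < t) : lconv f (g + h) t = lconv f g t + lconv f h t := by
  rw [lconv, lconv, lconv, ← intervalIntegral.integral_add (lconv_integrable hf hg ht)
    (lconv_integrable hf hh ht)]
  simp [mul_add]

theorem lconv_smul (c : 𝕜) (f g : ℝ → 𝕜) (t : ℝ) : lconv f (c • g) t = c • lconv f g t := by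
  rw [lconv, lconv, ← intervalIntegral.integral_smul]
  simp only [Pi.smul_apply, mul_smul_comm]

theorem lconv_zero_right {f g : ℝ → 𝕜} (h : ∀ t, 0 < t → g t = 0) {t : ℝ} (ht : 0 < t) :
    lconv f g t = 0 := by
  rw [lconv_congr (f' := f) (g' := fun _ => 0) (fun _ _ => rfl) h ht, lconv]
  simp

theorem lconv_mul_id {f g : ℝ → 𝕜} (hf : MemCm1 f) (hg : MemCm1 g) {t : ℝ} (ht : 0 < t) :
    (t : 𝕜) * lconv f g t =
      lconv (fun s => (s : 𝕜) * f s) g t + lconv f (fun s => (s : 𝕜) * g s) t := by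
  rw [lconv, lconv, lconv, ← intervalIntegral.integral_add (lconv_integrable hf.mul_id hg ht)
    (lconv_integrable hf hg.mul_id ht), ← intervalIntegral.integral_const_mul]
  congr 1
  funext τ
  push_cast
  ring

theorem lconv_zero_of_nonpos {f g : ℝ → 𝕜} (hg : ∀ t, t ≤ 0 → g t = 0) {t : ℝ} (ht : t ≤ 0) :
    lconv f g t = 0 := by
  rw [lconv, intervalIntegral.integral_symm, neg_eq_zero]
  refine intervalIntegral.integral_zero_ae (Eventually.of_forall fun τ hτ => ?_)
  rw [uIoc_of_le ht] at hτ
  rw [hg τ hτ.2, mul_zero]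

variable (𝕜) in
/-- `C₋₁(0,∞)` as a vector space: a function on `(0,∞)` is represented by its extension by zero. -/
def cm1 : Submodule 𝕜 (ℝ → 𝕜) where
  carrier := {f | MemCm1 f ∧ ∀ t, t ≤ 0 → f t = 0}
  add_mem' hf hg := ⟨hf.1.add hg.1, fun t ht => by simp [hf.2 t ht, hg.2 t ht]⟩
  zero_mem' := ⟨MemCm1.zero, fun _ _ => rfl⟩
  smul_mem' c f hf := ⟨hf.1.smul c, fun t ht => by simp [hf.2 t ht]⟩

variable (𝕜) in
/-- The ring `𝓡₋₁ = (C₋₁(0,∞), +, *)` whose multiplication is the Laplace convolution. It has no unit. -/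
def ConvRing : Type _ := cm1 𝕜

namespace ConvRing

instance : AddCommGroup (ConvRing 𝕜) := inferInstanceAs (AddCommGroup (cm1 𝕜))
instance : Module 𝕜 (ConvRing 𝕜) := inferInstanceAs (Module 𝕜 (cm1 𝕜))

/-- The ring element given by the restriction of `f` to `(0,∞)`. -/
def ofFun (f : ℝ → 𝕜) (hf : MemCm1 f) : ConvRing 𝕜 :=
  ⟨indicator (Ioi 0) f, hf.congr fun _ ht => indicator_of_mem (by exact ht) f,
    fun _ ht => indicator_of_notMem (by simpa using ht) f⟩

/-- The product of the ring is the Laplace convolution. -/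
instance : Mul (ConvRing 𝕜) :=
  ⟨fun f g => ⟨lconv f.1 g.1, f.2.1.lconv g.2.1, fun _ ht => lconv_zero_of_nonpos g.2.2 ht⟩⟩

theorem ext_pos {f g : ConvRing 𝕜} (h : ∀ t, 0 < t → f.1 t = g.1 t) : f = g := by
  refine Subtype.ext (funext fun t => ?_)
  rcases lt_or_ge 0 t with ht | ht
  · exact h t ht
  · rw [f.2.2 t ht, g.2.2 t ht]

instance : NonUnitalCommRing (ConvRing 𝕜) :=
  { (inferInstance : AddCommGroup (ConvRing 𝕜)), (inferInstance : Mul (ConvRing 𝕜)) with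
    mul_comm := fun f g => Subtype.ext (lconv_comm f.1 g.1)
    mul_assoc := fun f g h => ext_pos fun _ ht => lconv_assoc f.2.1 g.2.1 h.2.1 ht
    left_distrib := fun f g h => ext_pos fun _ ht => lconv_add f.2.1 g.2.1 h.2.1 ht
    right_distrib := fun f g h => ext_pos fun t ht => by
      change lconv (f.1 + g.1) h.1 t = lconv f.1 h.1 t + lconv g.1 h.1 t
      rw [lconv_comm, lconv_add h.2.1 f.2.1 g.2.1 ht, lconv_comm h.1, lconv_comm h.1]
    zero_mul := fun f => ext_pos fun t ht => by
      change lconv 0 f.1 t = 0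
      rw [lconv_comm]
      exact lconv_zero_right (fun _ _ => rfl) ht
    mul_zero := fun f => ext_pos fun _ ht => lconv_zero_right (fun _ _ => rfl) ht }

instance : SMulCommClass 𝕜 (ConvRing 𝕜) (ConvRing 𝕜) :=
  ⟨fun c f g => Subtype.ext (funext fun t => (lconv_smul c f.1 g.1 t).symm)⟩

instance : IsScalarTower 𝕜 (ConvRing 𝕜) (ConvRing 𝕜) :=
  ⟨fun c f g => by
    rw [smul_eq_mul, smul_eq_mul, mul_comm, mul_smul_comm, mul_comm]⟩

theorem eq_zero_of_mul_self {f : ConvRing ℂ} (h : f * f = 0) : f = 0 :=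
  ext_pos fun t ht => lconv_self_eq_zero f.2.1 (fun s _ => congrFun (congrArg Subtype.val h) s) t ht

/-- Multiplication by the independent variable, a derivation of the convolution ring. -/
def mulId (f : ConvRing ℂ) : ConvRing ℂ :=
  ⟨fun t => (t : ℂ) * f.1 t, f.2.1.mul_id, fun t ht => by simp [f.2.2 t ht]⟩

theorem mul_mulId {f g : ConvRing ℂ} (h : f * g = 0) : f * mulId g = 0 := by
  have h1 : mulId f * g + f * mulId g = 0 := ext_pos fun t ht => by
    have h2 := lconv_mul_id f.2.1 g.2.1 ht
    have h3 : lconv f.1 g.1 t = 0 := congrFun (congrArg Subtype.val h) t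
    rw [h3, mul_zero] at h2
    exact h2.symm
  refine eq_zero_of_mul_self ?_
  calc f * mulId g * (f * mulId g) = f * mulId g * (-(mulId f * g)) := by
        rw [eq_neg_of_add_eq_zero_right h1]
    _ = -((f * g) * (mulId g * mulId f)) := by rw [mul_neg]; congr 1; ac_rfl
    _ = 0 := by rw [h, zero_mul, neg_zero]

theorem mul_eq_zero_complex {f g : ConvRing ℂ} (h : f * g = 0) : f = 0 ∨ g = 0 := by
  have hn : ∀ n : ℕ, f * (mulId^[n] g) = 0 := by
    intro n
    induction n with
    | zero => exact h
    | succ n ih => rw [Function.iterate_succ_apply']; exact mul_mulId ih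
  have hv : ∀ n : ℕ, ∀ t : ℝ, (mulId^[n] g).1 t = ((t ^ n : ℝ) : ℂ) * g.1 t := by
    intro n
    induction n with
    | zero => intro t; simp
    | succ n ih =>
      intro t
      rw [Function.iterate_succ_apply']
      change (t : ℂ) * (mulId^[n] g).1 t = _
      rw [ih]; push_cast; ring
  have key : ∀ t, 0 < t → ∀ τ ∈ Ioo 0 t, f.1 (t - τ) * g.1 τ = 0 := by
    intro t ht
    refine moments_zero ht (lconv_integrable f.2.1 g.2.1 ht) ?_ fun n => ?_
    · exact (f.2.1.continuousOn.comp (by fun_prop) fun u hu => sub_pos.2 hu.2).mul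
        (g.2.1.continuousOn.mono Ioo_subset_Ioi_self)
    · have h1 : lconv f.1 (mulId^[n] g).1 t = 0 := congrFun (congrArg Subtype.val (hn n)) t
      rw [lconv] at h1
      rw [← h1]
      congr 1
      funext τ
      rw [hv]
      exact mul_left_comm _ _ _
  by_cases hg : g = 0
  · exact Or.inr hg
  · refine Or.inl (ext_pos fun s hs => ?_)
    by_contra hne
    refine hg (ext_pos fun τ hτ => ?_)
    have h1 := key (s + τ) (by positivity) τ ⟨hτ, by linarith⟩
    rw [add_sub_cancel_right] at h1
    exact (mul_eq_zero.1 h1).resolve_left hne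

/-- The convolution ring has no divisors of zero (Titchmarsh). -/
instance : NoZeroDivisors (ConvRing 𝕜) where
  eq_zero_or_eq_zero_of_mul_eq_zero {f g} h := by
    let φ := RCLike.map 𝕜 ℂ
    have hmul : ∀ x y, φ (x * y) = φ x * φ y := by
      intro x y
      apply Complex.ext <;> simp [φ, RCLike.map_apply]
    have hinj : ∀ x, φ x = 0 → x = 0 := by
      intro x hx
      have h1 := congrArg Complex.re hx
      have h2 := congrArg Complex.im hx
      simp [φ, RCLike.map_apply] at h1 h2
      exact RCLike.ext (by simpa using h1) (by simpa using h2)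
    have hmem : ∀ k : ConvRing 𝕜, MemCm1 (fun t => φ (k.1 t)) := by
      rintro ⟨k, ⟨p, hp, k₁, hk₁, hk⟩, _⟩
      exact ⟨p, hp, fun t => φ (k₁ t), φ.continuous.comp_continuousOn hk₁, fun t ht => by
        simp only [hk t ht, map_smul]⟩
    let Φ : ConvRing 𝕜 → ConvRing ℂ := fun k =>
      ⟨fun t => φ (k.1 t), hmem k, fun t ht =>
        (congrArg φ (k.2.2 t ht)).trans (map_zero φ)⟩
    have hΦ : Φ f * Φ g = 0 := ext_pos fun t ht => by
      have h1 : lconv f.1 g.1 t = 0 := congrFun (congrArg Subtype.val h) t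
      have h2 := φ.intervalIntegral_comp_comm (lconv_integrable f.2.1 g.2.1 ht)
      rw [← lconv, h1, map_zero] at h2
      simp only [hmul] at h2
      exact h2
    have h0 : ∀ k, Φ k = 0 → k = 0 := fun k hk => ext_pos fun t _ =>
      hinj _ (congrFun (congrArg Subtype.val hk) t)
    exact (mul_eq_zero_complex hΦ).imp (h0 f) (h0 g)

end ConvRing

section Quotients

variable (R : Type*) [NonUnitalCommRing R] [NoZeroDivisors R]

/-- The relation `(f₁, g₁) ∼ (f₂, g₂) ↔ f₁ * g₂ = f₂ * g₁` on pairs with non-zero second entry. -/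
def quotSetoid : Setoid (R × {g : R // g ≠ 0}) where
  r x y := x.1 * y.2.1 = y.1 * x.2.1
  iseqv :=
    { refl := fun _ => rfl
      symm := fun h => h.symm
      trans := fun {x y z} h h' => by
        have e : (x.1 * z.2.1 - z.1 * x.2.1) * y.2.1 = 0 := by
          rw [sub_mul, sub_eq_zero]
          calc x.1 * z.2.1 * y.2.1 = x.1 * y.2.1 * z.2.1 := by ac_rfl
            _ = y.1 * z.2.1 * x.2.1 := by rw [h]; ac_rfl
            _ = z.1 * x.2.1 * y.2.1 := by rw [h']; ac_rfl
        exact sub_eq_zero.1 ((mul_eq_zero.1 e).resolve_right y.2.2) }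

/-- The quotients `f / g`, `g ≠ 0`, of a commutative ring without divisors of zero (and possibly
without unit). -/
def ConvQuot : Type _ := Quotient (quotSetoid R)

namespace ConvQuot

variable {R}

/-- The class `f / g`. -/
def mk (f g : R) (hg : g ≠ 0) : ConvQuot R := Quotient.mk (quotSetoid R) (f, ⟨g, hg⟩)

theorem mk_eq_mk {f₁ g₁ f₂ g₂ : R} {h₁ : g₁ ≠ 0} {h₂ : g₂ ≠ 0} :
    mk f₁ g₁ h₁ = mk f₂ g₂ h₂ ↔ f₁ * g₂ = f₂ * g₁ := Quotient.eq (r := quotSetoid R)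

theorem ind {P : ConvQuot R → Prop} (h : ∀ f g hg, P (mk f g hg)) (x : ConvQuot R) : P x :=
  Quotient.inductionOn x fun y => h y.1 y.2.1 y.2.2

/-- `f₁ / g₁ + f₂ / g₂ = (f₁ * g₂ + f₂ * g₁) / (g₁ * g₂)`. -/
instance : Add (ConvQuot R) :=
  ⟨Quotient.map₂ (fun x y => (x.1 * y.2.1 + y.1 * x.2.1, ⟨x.2.1 * y.2.1, mul_ne_zero x.2.2 y.2.2⟩))
    fun x x' (h : x.1 * x'.2.1 = x'.1 * x.2.1) y y' (h' : y.1 * y'.2.1 = y'.1 * y.2.1) => by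
      change (x.1 * y.2.1 + y.1 * x.2.1) * (x'.2.1 * y'.2.1) =
        (x'.1 * y'.2.1 + y'.1 * x'.2.1) * (x.2.1 * y.2.1)
      rw [add_mul, add_mul]
      congr 1
      · calc x.1 * y.2.1 * (x'.2.1 * y'.2.1) = x.1 * x'.2.1 * (y.2.1 * y'.2.1) := by ac_rfl
          _ = _ := by rw [h]; ac_rfl
      · calc y.1 * x.2.1 * (x'.2.1 * y'.2.1) = y.1 * y'.2.1 * (x.2.1 * x'.2.1) := by ac_rfl
          _ = _ := by rw [h']; ac_rfl⟩

/-- `(f₁ / g₁) · (f₂ / g₂) = (f₁ * f₂) / (g₁ * g₂)`. -/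
instance : Mul (ConvQuot R) :=
  ⟨Quotient.map₂ (fun x y => (x.1 * y.1, ⟨x.2.1 * y.2.1, mul_ne_zero x.2.2 y.2.2⟩))
    fun x x' (h : x.1 * x'.2.1 = x'.1 * x.2.1) y y' (h' : y.1 * y'.2.1 = y'.1 * y.2.1) => by
      change (x.1 * y.1) * (x'.2.1 * y'.2.1) = (x'.1 * y'.1) * (x.2.1 * y.2.1)
      calc (x.1 * y.1) * (x'.2.1 * y'.2.1) = (x.1 * x'.2.1) * (y.1 * y'.2.1) := by ac_rfl
        _ = _ := by rw [h, h']; ac_rfl⟩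

instance : Neg (ConvQuot R) :=
  ⟨Quotient.map (fun x => (-x.1, x.2)) fun x x' (h : x.1 * x'.2.1 = x'.1 * x.2.1) => by
      change -x.1 * x'.2.1 = -x'.1 * x.2.1
      rw [neg_mul, neg_mul, h]⟩

/-- Scalar multiplication `c • (f / g) = (c • f) / g`. -/
def scalarMul {K : Type*} [SMul K R] [IsScalarTower K R R] (c : K) : ConvQuot R → ConvQuot R :=
  Quotient.map (fun x => (c • x.1, x.2)) fun x x' (h : x.1 * x'.2.1 = x'.1 * x.2.1) => by
    change (c • x.1) * x'.2.1 = (c • x'.1) * x.2.1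
    rw [smul_mul_assoc, smul_mul_assoc, h]

theorem mk_add_mk (f₁ g₁ f₂ g₂ : R) (h₁ : g₁ ≠ 0) (h₂ : g₂ ≠ 0) :
    mk f₁ g₁ h₁ + mk f₂ g₂ h₂ = mk (f₁ * g₂ + f₂ * g₁) (g₁ * g₂) (mul_ne_zero h₁ h₂) := rfl

theorem mk_mul_mk (f₁ g₁ f₂ g₂ : R) (h₁ : g₁ ≠ 0) (h₂ : g₂ ≠ 0) :
    mk f₁ g₁ h₁ * mk f₂ g₂ h₂ = mk (f₁ * f₂) (g₁ * g₂) (mul_ne_zero h₁ h₂) := rfl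

theorem neg_mk (f g : R) (h : g ≠ 0) : -mk f g h = mk (-f) g h := rfl

variable [Nontrivial R]

instance : Zero (ConvQuot R) :=
  ⟨mk 0 (exists_ne (0 : R)).choose (exists_ne (0 : R)).choose_spec⟩

/-- The unit element `I = g / g`, for any `g ≠ 0`. -/
instance : One (ConvQuot R) :=
  ⟨mk (exists_ne (0 : R)).choose (exists_ne (0 : R)).choose (exists_ne (0 : R)).choose_spec⟩

theorem mk_eq_zero {f g : R} {h : g ≠ 0} : mk f g h = 0 ↔ f = 0 := by
  refine mk_eq_mk.trans ?_
  rw [zero_mul, mul_eq_zero, or_iff_left (exists_ne (0 : R)).choose_spec]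

theorem mk_self {f : R} (h : f ≠ 0) : mk f f h = 1 := mk_eq_mk.2 (mul_comm _ _)

open Classical in
instance : Inv (ConvQuot R) :=
  ⟨Quotient.lift (fun x : R × {g : R // g ≠ 0} => if h : x.1 = 0 then 0 else mk x.2.1 x.1 h)
    fun x y (hxy : x.1 * y.2.1 = y.1 * x.2.1) => by
      by_cases hx : x.1 = 0
      · have hy : y.1 = 0 := by
          rw [hx, zero_mul] at hxy
          exact (mul_eq_zero.1 hxy.symm).resolve_right x.2.2
        simp only [dif_pos hx, dif_pos hy]
      · have hy : y.1 ≠ 0 := fun hy => by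
          rw [hy, zero_mul] at hxy
          exact hx ((mul_eq_zero.1 hxy).resolve_right y.2.2)
        simp only [dif_neg hx, dif_neg hy]
        exact mk_eq_mk.2 (by rw [mul_comm, ← hxy, mul_comm])⟩

theorem inv_mk {f g : R} (h : g ≠ 0) (hf : f ≠ 0) : (mk f g h)⁻¹ = mk g f hf := dif_neg hf

theorem inv_zero' : (0 : ConvQuot R)⁻¹ = 0 := dif_pos rfl

/-- The quotients form a field with the operations above. -/
instance : Field (ConvQuot R) where
  add_assoc := ind fun f₁ g₁ h₁ => ind fun f₂ g₂ h₂ => ind fun f₃ g₃ h₃ => by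
    refine mk_eq_mk.2 ?_
    simp only [add_mul]
    rw [add_assoc]
    congr 1
    · ac_rfl
    · congr 1 <;> ac_rfl
  zero_add := ind fun f g h => mk_eq_mk.2 (by rw [zero_mul, zero_add]; dsimp only; ac_rfl)
  add_zero := ind fun f g h => mk_eq_mk.2 (by rw [zero_mul, add_zero]; dsimp only; ac_rfl)
  add_comm := ind fun f₁ g₁ h₁ => ind fun f₂ g₂ h₂ =>
    mk_eq_mk.2 (by rw [add_comm, mul_comm g₁ g₂])
  neg_add_cancel := ind fun f g h => mk_eq_zero.2 (by rw [neg_mul, neg_add_cancel])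
  mul_assoc := ind fun f₁ g₁ h₁ => ind fun f₂ g₂ h₂ => ind fun f₃ g₃ h₃ => mk_eq_mk.2 (by dsimp only; ac_rfl)
  mul_comm := ind fun f₁ g₁ h₁ => ind fun f₂ g₂ h₂ => mk_eq_mk.2 (by dsimp only; ac_rfl)
  one_mul := ind fun f g h => mk_eq_mk.2 (by dsimp only; ac_rfl)
  mul_one := ind fun f g h => mk_eq_mk.2 (by dsimp only; ac_rfl)
  zero_mul := ind fun f g h => mk_eq_zero.2 (zero_mul f)
  mul_zero := ind fun f g h => mk_eq_zero.2 (mul_zero f)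
  left_distrib := ind fun f₁ g₁ h₁ => ind fun f₂ g₂ h₂ => ind fun f₃ g₃ h₃ => by
    refine mk_eq_mk.2 ?_
    simp only [mul_add, add_mul]
    congr 1 <;> ac_rfl
  right_distrib := ind fun f₁ g₁ h₁ => ind fun f₂ g₂ h₂ => ind fun f₃ g₃ h₃ => by
    refine mk_eq_mk.2 ?_
    simp only [add_mul]
    congr 1 <;> ac_rfl
  exists_pair_ne := ⟨0, 1, fun h => (exists_ne (0 : R)).choose_spec (mk_eq_zero.1 h.symm)⟩
  mul_inv_cancel := ind fun f g h hne => by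
    have hf : f ≠ 0 := fun hf => hne (mk_eq_zero.2 hf)
    rw [inv_mk h hf]
    exact mk_eq_mk.2 (by dsimp only; ac_rfl)
  inv_zero := inv_zero'
  nsmul := nsmulRec
  zsmul := zsmulRec
  nnqsmul := _
  qsmul := _

end ConvQuot

end Quotients

instance : Nontrivial (ConvRing 𝕜) :=
  ⟨⟨ConvRing.ofFun (fun _ => 1) MemCm1.one, 0, fun h => by
    have h1 : indicator (Ioi (0 : ℝ)) (fun _ => (1 : 𝕜)) 1 = 0 :=
      congrFun (congrArg Subtype.val h) 1
    rw [indicator_of_mem (mem_Ioi.2 one_pos)] at h1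
    exact one_ne_zero h1⟩⟩

variable (𝕜) in
/-- The field `𝓕₋₁` of convolution quotients of functions from `C₋₁(0,∞)`. -/
abbrev HyperField : Type _ := ConvQuot (ConvRing 𝕜)

/-- Scalar multiplication on `𝓕₋₁`: `c • (f / g) = (c • f) / g`. -/
instance : SMul 𝕜 (HyperField 𝕜) := ⟨fun c x => ConvQuot.scalarMul c x⟩

/-- The general fractional integral `(𝕀_(k) f)(t) = ∫₀ᵗ k(t - τ) f(τ) dτ`. -/
def gfi (k f : ℝ → 𝕜) : ℝ → 𝕜 := lconv k f

/-- The derivative `𝔻_(k) f = d/dt 𝕀_(k) f` (meaningful where `𝕀_(k) f` is differentiable). -/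
def rlGFD (k f : ℝ → 𝕜) : ℝ → 𝕜 := deriv (gfi k f)

/-- The 1st level general fractional derivative `𝕀_(k₁) d/dt 𝕀_(k₂) f`. -/
def gfd (k₁ k₂ f : ℝ → 𝕜) : ℝ → 𝕜 := gfi k₁ (deriv (gfi k₂ f))

/-- The 1st level derivative of `f` exists classically at the point `t`: the inner integral
converges and is differentiable on `(0, t]`, and the outer integral of its derivative converges. -/
def GFDExistsAt (k₁ k₂ f : ℝ → 𝕜) (t : ℝ) : Prop :=
  (∀ s ∈ Ioc 0 t, IntervalIntegrable (fun τ => k₂ (s - τ) * f τ) volume 0 s ∧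
    DifferentiableAt ℝ (gfi k₂ f) s) ∧
  IntervalIntegrable (fun τ => k₁ (t - τ) * deriv (gfi k₂ f) τ) volume 0 t

/-- The space `C¹_{-1,(k)}(0,∞)`: those `f ∈ C₋₁(0,∞)` for which `𝔻_(k) f` exists on `(0,∞)` and
belongs to `C₋₁(0,∞)`. -/
structure MemC1 (k f : ℝ → 𝕜) : Prop where
  mem : MemCm1 f
  differentiableAt : ∀ t : ℝ, 0 < t → DifferentiableAt ℝ (gfi k f) t
  mem_rlGFD : MemCm1 (rlGFD k f)

/-- The value `(𝕀_(k) f)(0)` of (the continuous extension to `[0,∞)` of) `𝕀_(k) f` at the origin,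
that is, the limit from the right. -/
def initialValue (k f : ℝ → 𝕜) : 𝕜 := limUnder (𝓝[>] (0 : ℝ)) (gfi k f)

/-- Triples `(κ, k₁, k₂)` of 1st level kernels from `C₋₁(0,∞)`: `κ * k₁ * k₂ = 1` on `(0,∞)`. -/
structure FirstLevelKernels (κ k₁ k₂ : ℝ → 𝕜) : Prop where
  mem_κ : MemCm1 κ
  mem_k₁ : MemCm1 k₁
  mem_k₂ : MemCm1 k₂
  conv_eq_one : ∀ t : ℝ, 0 < t → lconv (lconv κ k₁) k₂ t = 1

/-- The projector `P f = (𝕀_(k₂) f)(0) · (κ * k₁)` of the 1st level derivative. -/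
def projector (κ k₁ k₂ f : ℝ → 𝕜) : ℝ → 𝕜 := initialValue k₂ f • lconv κ k₁

namespace FirstLevelKernels

variable {κ k₁ k₂ : ℝ → 𝕜}

/-- The kernel `κ` as an element of the convolution ring. -/
def kappa (hk : FirstLevelKernels κ k₁ k₂) : ConvRing 𝕜 := ConvRing.ofFun κ hk.mem_κ

theorem kappa_ne_zero (hk : FirstLevelKernels κ k₁ k₂) : hk.kappa ≠ 0 := by
  intro h
  have h1 : ∀ t, 0 < t → κ t = 0 := fun t ht => by
    have h2 : indicator (Ioi (0 : ℝ)) κ t = 0 := congrFun (congrArg Subtype.val h) t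
    rwa [indicator_of_mem (by exact ht)] at h2
  have h2 : ∀ t, 0 < t → lconv κ k₁ t = 0 := fun t ht => by
    rw [lconv_comm]; exact lconv_zero_right h1 ht
  have h3 := hk.conv_eq_one 1 one_pos
  rw [lconv_comm, lconv_zero_right h2 one_pos] at h3
  exact zero_ne_one h3

/-- A function `f ∈ C₋₁(0,∞)` as the element `(f * κ) / κ` of the field `𝓕₋₁`. -/
def embed (hk : FirstLevelKernels κ k₁ k₂) (f : ℝ → 𝕜) (hf : MemCm1 f) : HyperField 𝕜 :=
  ConvQuot.mk (ConvRing.ofFun f hf * hk.kappa) hk.kappa hk.kappa_ne_zero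

/-- The algebraic inverse `S_κ = κ / κ^{<2>}`, where `κ^{<2>} = κ * κ`. -/
def algInv (hk : FirstLevelKernels κ k₁ k₂) : HyperField 𝕜 :=
  ConvQuot.mk hk.kappa (hk.kappa * hk.kappa) (mul_ne_zero hk.kappa_ne_zero hk.kappa_ne_zero)

theorem algInv_mul_embed (hk : FirstLevelKernels κ k₁ k₂) :
    hk.algInv * hk.embed κ hk.mem_κ = 1 := by
  rw [← ConvQuot.mk_self hk.kappa_ne_zero]
  refine ConvQuot.mk_eq_mk.2 ?_
  change hk.kappa * (hk.kappa * hk.kappa) * hk.kappa = hk.kappa * (hk.kappa * hk.kappa * hk.kappa)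
  ac_rfl

theorem mem_projector (hk : FirstLevelKernels κ k₁ k₂) (f : ℝ → 𝕜) :
    MemCm1 (projector κ k₁ k₂ f) := (hk.mem_κ.lconv hk.mem_k₁).smul _

/-- The 1st level algebraic general fractional derivative `S_κ · f - S_κ · (P f)`. -/
def agfd (hk : FirstLevelKernels κ k₁ k₂) (f : ℝ → 𝕜) (hf : MemCm1 f) : HyperField 𝕜 :=
  hk.algInv * hk.embed f hf -
    hk.algInv * hk.embed (projector κ k₁ k₂ f) (hk.mem_projector f)

end FirstLevelKernels

end
end GFDCalculus

open GFDCalculus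

/-! ### Functions as elements of the convolution ring -/

namespace GFDCalculus

variable {𝕜 : Type*} [RCLike 𝕜]

/-! Write `c` for `(𝕀_(k₂) f)(0)` and `D` for the derivative of `k₂ * f`. Since `D` lies in `C₋₁`,
it behaves at worst like `t ^ p` with `p > -1` near the origin and is integrable there. Hence `k₂ *
f` has a limit `c` at `0+`, and `k₂ * f = c · 1 + 1 * D` on `(0,∞)` (`MemC1.gfi_eq`).

The rest is algebra. In the convolution ring the constant function `1` equals `κ * k₁ * k₂`, so both
summands on the right contain the factor `k₂`: `k₂ * (f - c · (κ * k₁) - κ * (k₁ * D)) = 0`. Here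
`k₂ ≠ 0`, and the ring has no divisors of zero (Titchmarsh), so `f = P f + κ * (k₁ * D)`. This is
`FirstLevelKernels.eq_projector_add`, and `k₁ * D` is the 1st level derivative.

In the field of quotients, multiplication by `S_κ` removes one factor `κ`
(`algInv_mul_embed_lconv`). Applied to this identity it gives `S_κ · f - S_κ · P f = k₁ * D`;
applied to `P f = κ * (c k₁)` it gives `S_κ · P f = c k₁`. -/

theorem ConvRing.ofFun_apply {f : ℝ → 𝕜} (hf : MemCm1 f) {t : ℝ} (ht : 0 < t) :
    (ConvRing.ofFun f hf).1 t = f t :=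
  indicator_of_mem (mem_Ioi.2 ht) f

theorem ConvRing.ofFun_eq_ofFun {f g : ℝ → 𝕜} {hf : MemCm1 f} {hg : MemCm1 g} :
    ConvRing.ofFun f hf = ConvRing.ofFun g hg ↔ ∀ t, 0 < t → f t = g t := by
  refine ⟨fun h t ht => ?_, fun h => ConvRing.ext_pos fun t ht => ?_⟩
  · rw [← ofFun_apply hf ht, ← ofFun_apply hg ht, h]
  · rw [ofFun_apply hf ht, ofFun_apply hg ht, h t ht]

theorem ConvRing.ofFun_add {f g : ℝ → 𝕜} (hf : MemCm1 f) (hg : MemCm1 g) :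
    ConvRing.ofFun (f + g) (hf.add hg) = ConvRing.ofFun f hf + ConvRing.ofFun g hg :=
  ConvRing.ext_pos fun t ht => by
    change _ = (ConvRing.ofFun f hf).1 t + (ConvRing.ofFun g hg).1 t
    rw [ofFun_apply _ ht, ofFun_apply _ ht, ofFun_apply _ ht, Pi.add_apply]

theorem ConvRing.ofFun_smul (c : 𝕜) {f : ℝ → 𝕜} (hf : MemCm1 f) :
    ConvRing.ofFun (c • f) (hf.smul c) = c • ConvRing.ofFun f hf :=
  ConvRing.ext_pos fun t ht => by
    change _ = c • (ConvRing.ofFun f hf).1 t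
    rw [ofFun_apply _ ht, ofFun_apply _ ht, Pi.smul_apply]

/-- The convolution at `t > 0` only samples its factors on `(0,t)`, so cutting them off to zero on
the negative half-line changes nothing. -/
theorem ConvRing.ofFun_lconv {f g : ℝ → 𝕜} (hf : MemCm1 f) (hg : MemCm1 g) :
    ConvRing.ofFun (lconv f g) (hf.lconv hg) = ConvRing.ofFun f hf * ConvRing.ofFun g hg :=
  ConvRing.ext_pos fun t ht => by
    change _ = lconv (ConvRing.ofFun f hf).1 (ConvRing.ofFun g hg).1 t
    rw [ofFun_apply _ ht]
    exact lconv_congr (fun s hs => (ofFun_apply hf hs).symm)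
      (fun s hs => (ofFun_apply hg hs).symm) ht

/-! ### Behaviour of `𝕀_(k) f` at the origin -/

namespace MemC1

variable {k f : ℝ → 𝕜}

/-- The derivative lies in `C₋₁`, so it is continuous on `(0,∞)` but may be singular at `0`. Keeping
`s > 0` stays within reach of the fundamental theorem of calculus; the endpoint `0` is reached
afterwards by a limit. -/
theorem gfi_sub_gfi (hf : MemC1 k f) {s t : ℝ} (hs : 0 < s) (hst : s ≤ t) :
    gfi k f t - gfi k f s = ∫ τ in s..t, rlGFD k f τ := by
  have hsub : uIcc s t ⊆ Ioi 0 := by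
    rw [uIcc_of_le hst]
    exact fun x hx => hs.trans_le hx.1
  exact (intervalIntegral.integral_eq_sub_of_hasDerivAt
    (fun x hx => (hf.differentiableAt x (hsub hx)).hasDerivAt)
    (hf.mem_rlGFD.continuousOn.mono hsub).intervalIntegrable).symm

/-- Integrability of the derivative up to `0` lets `s → 0+` in `gfi_sub_gfi`. The limit need not be
`gfi k f 0`, which is an integral over a degenerate interval and hence always `0`. -/
theorem tendsto_gfi (hf : MemC1 k f) {t : ℝ} (ht : 0 < t) :
    Tendsto (gfi k f) (𝓝[>] 0) (𝓝 (gfi k f t - ∫ τ in (0 : ℝ)..t, rlGFD k f τ)) := by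
  have hint : IntervalIntegrable (rlGFD k f) volume 0 t := hf.mem_rlGFD.intervalIntegrable ht
  -- The primitive is based at `t`, so that the moving limit of integration can tend to the endpoint
  -- `0`.
  have hcont : ContinuousOn (fun s => ∫ τ in t..s, rlGFD k f τ) (uIcc t 0) :=
    intervalIntegral.continuousOn_primitive_interval
      ((intervalIntegrable_iff' (by simp)).1 hint.symm)
  have hlim : Tendsto (fun s => ∫ τ in t..s, rlGFD k f τ) (𝓝[>] 0)
      (𝓝 (∫ τ in t..(0 : ℝ), rlGFD k f τ)) := by
    refine (hcont 0 right_mem_uIcc).mono_left ?_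
    rw [uIcc_of_ge ht.le, ← nhdsWithin_Ioc_eq_nhdsGT ht]
    exact nhdsWithin_mono 0 Ioc_subset_Icc_self
  rw [intervalIntegral.integral_symm, sub_neg_eq_add]
  refine (tendsto_const_nhds.add hlim).congr' ?_
  filter_upwards [Ioc_mem_nhdsGT ht] with s hs
  rw [intervalIntegral.integral_symm, ← hf.gfi_sub_gfi hs.1 hs.2]
  ring

/-- `initialValue` is a `limUnder`, which is meaningful only once some limit is known to exist; the
choice of the base point `1` is immaterial. -/
theorem tendsto_initialValue (hf : MemC1 k f) :
    Tendsto (gfi k f) (𝓝[>] 0) (𝓝 (initialValue k f)) :=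
  tendsto_nhds_limUnder ⟨_, hf.tendsto_gfi one_pos⟩

/-- By uniqueness of limits the limit found in `tendsto_gfi` is the initial value, whatever `t` is.
Integration from `0` is written as convolution with the constant `1`, the form in which it can be
carried into the ring. -/
theorem gfi_eq (hf : MemC1 k f) {t : ℝ} (ht : 0 < t) :
    gfi k f t = initialValue k f + lconv (fun _ => 1) (rlGFD k f) t := by
  have h := tendsto_nhds_unique hf.tendsto_initialValue (hf.tendsto_gfi ht)
  rw [h, lconv]
  simp

/-- Both integrals are convolutions of members of `C₋₁`: the singularities of the two factors sit at
opposite ends of the interval, and each is integrable. -/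
theorem gfdExistsAt {k₁ : ℝ → 𝕜} (hk₁ : MemCm1 k₁) (hk : MemCm1 k) (hf : MemC1 k f) {t : ℝ}
    (ht : 0 < t) : GFDExistsAt k₁ k f t :=
  ⟨fun s hs => ⟨lconv_integrable hk hf.mem hs.1, hf.differentiableAt s hs.1⟩,
    lconv_integrable hk₁ hf.mem_rlGFD ht⟩

end MemC1

/-! ### The fundamental theorem by cancellation of `k₂` -/

namespace FirstLevelKernels

variable {κ k₁ k₂ : ℝ → 𝕜}

/-- The constant function `1` is not a unit of the ring: multiplication by it is integration. Its
factorization through the kernels is what allows `k₂` to be cancelled later. -/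
theorem ofFun_one (hk : FirstLevelKernels κ k₁ k₂) :
    ConvRing.ofFun (fun _ => (1 : 𝕜)) MemCm1.one =
      hk.kappa * ConvRing.ofFun k₁ hk.mem_k₁ * ConvRing.ofFun k₂ hk.mem_k₂ := by
  rw [kappa, ← ConvRing.ofFun_lconv, ← ConvRing.ofFun_lconv]
  exact ConvRing.ofFun_eq_ofFun.2 fun t ht => (hk.conv_eq_one t ht).symm

/-- If `k₂` vanished, so would the product `κ * k₁ * k₂`, contradicting its value `1` at `t = 1`. -/
theorem ofFun_k₂_ne_zero (hk : FirstLevelKernels κ k₁ k₂) :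
    ConvRing.ofFun k₂ hk.mem_k₂ ≠ 0 := by
  intro h
  have h1 := hk.ofFun_one
  rw [h, mul_zero] at h1
  have h2 := congrFun (congrArg Subtype.val h1) 1
  rw [ConvRing.ofFun_apply _ one_pos] at h2
  exact one_ne_zero h2

/-- The fundamental theorem of calculus for the 1st level derivative:
`f = P f + κ * (𝕀_(k₁) d/dt 𝕀_(k₂) f)`. -/
theorem eq_projector_add (hk : FirstLevelKernels κ k₁ k₂) {f : ℝ → 𝕜} (hf : MemC1 k₂ f) {t : ℝ}
    (ht : 0 < t) : f t = projector κ k₁ k₂ f t + gfi κ (gfd k₁ k₂ f) t := by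
  have hD : MemCm1 (gfd k₁ k₂ f) := hk.mem_k₁.lconv hf.mem_rlGFD
  have hP := hk.mem_projector f
  -- The ring form of `gfi_eq`, with `rlGFD k₂ f` as the derivative.
  have hrep : ConvRing.ofFun k₂ hk.mem_k₂ * ConvRing.ofFun f hf.mem =
      initialValue k₂ f • ConvRing.ofFun (fun _ => (1 : 𝕜)) MemCm1.one +
        ConvRing.ofFun (fun _ => (1 : 𝕜)) MemCm1.one *
          ConvRing.ofFun (rlGFD k₂ f) hf.mem_rlGFD := by
    rw [← ConvRing.ofFun_lconv, ← ConvRing.ofFun_lconv, ← ConvRing.ofFun_smul,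
      ← ConvRing.ofFun_add]
    refine ConvRing.ofFun_eq_ofFun.2 fun s hs => ?_
    simpa [gfi] using hf.gfi_eq hs
  have hG : MemCm1 (gfi κ (gfd k₁ k₂ f)) := hk.mem_κ.lconv hD
  have hproj : ConvRing.ofFun (projector κ k₁ k₂ f) hP =
      initialValue k₂ f • (hk.kappa * ConvRing.ofFun k₁ hk.mem_k₁) := by
    rw [kappa, ← ConvRing.ofFun_lconv, ← ConvRing.ofFun_smul]
    rfl
  have hgfd : ConvRing.ofFun (gfi κ (gfd k₁ k₂ f)) hG =
      hk.kappa * (ConvRing.ofFun k₁ hk.mem_k₁ * ConvRing.ofFun (rlGFD k₂ f) hf.mem_rlGFD) := by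
    rw [kappa, ← ConvRing.ofFun_lconv, ← ConvRing.ofFun_lconv]
    rfl
  -- Replacing `1` by `κ * k₁ * k₂` in both terms of `hrep` exposes a common factor `k₂`; the two
  -- sides then agree up to reordering.
  have hzero : ConvRing.ofFun k₂ hk.mem_k₂ * (ConvRing.ofFun f hf.mem -
      ConvRing.ofFun (projector κ k₁ k₂ f + gfi κ (gfd k₁ k₂ f)) (hP.add hG)) = 0 := by
    rw [ConvRing.ofFun_add hP hG, hproj, hgfd, mul_sub, hrep, hk.ofFun_one,
      sub_eq_zero, mul_add, mul_smul_comm]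
    congr 1
    · congr 1; ac_rfl
    · ac_rfl
  -- Titchmarsh's theorem enters here: `k₂` has no inverse within the ring, but it can be cancelled.
  have heq := sub_eq_zero.1 ((mul_eq_zero.1 hzero).resolve_left hk.ofFun_k₂_ne_zero)
  exact ConvRing.ofFun_eq_ofFun.1 heq t ht

/-! ### Passage to the field of quotients -/

theorem embed_congr (hk : FirstLevelKernels κ k₁ k₂) {f g : ℝ → 𝕜} (hf : MemCm1 f)
    (hg : MemCm1 g) (h : ∀ t, 0 < t → f t = g t) : hk.embed f hf = hk.embed g hg := by
  rw [embed, embed, ConvRing.ofFun_eq_ofFun.2 h]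

theorem embed_add (hk : FirstLevelKernels κ k₁ k₂) {f g : ℝ → 𝕜} (hf : MemCm1 f)
    (hg : MemCm1 g) : hk.embed (f + g) (hf.add hg) = hk.embed f hf + hk.embed g hg := by
  rw [embed, embed, embed, ConvQuot.mk_add_mk, ConvQuot.mk_eq_mk, ConvRing.ofFun_add hf hg,
    add_mul, add_mul, add_mul]
  congr 1 <;> ac_rfl

theorem embed_smul (hk : FirstLevelKernels κ k₁ k₂) (c : 𝕜) {f : ℝ → 𝕜} (hf : MemCm1 f) :
    hk.embed (c • f) (hf.smul c) = c • hk.embed f hf := by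
  change _ = ConvQuot.mk (c • (ConvRing.ofFun f hf * hk.kappa)) hk.kappa hk.kappa_ne_zero
  rw [embed, ConvRing.ofFun_smul, smul_mul_assoc]

/-- `S_κ` inverts `κ`: after cross-multiplication both sides are `f` times four factors `κ`. -/
theorem algInv_mul_embed_lconv (hk : FirstLevelKernels κ k₁ k₂) {f : ℝ → 𝕜} (hf : MemCm1 f) :
    hk.algInv * hk.embed (lconv κ f) (hk.mem_κ.lconv hf) = hk.embed f hf := by
  rw [algInv, embed, embed, ConvQuot.mk_mul_mk, ConvQuot.mk_eq_mk, ConvRing.ofFun_lconv hk.mem_κ hf]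
  -- `ConvRing.ofFun κ hk.mem_κ` is folded back into `hk.kappa`, so that all factors `κ` are the
  -- same atom for `ac_rfl`.
  change hk.kappa * (hk.kappa * _ * hk.kappa) * hk.kappa = _
  ac_rfl

/-- With the scalar moved inside the convolution, the projector is `κ * (c k₁)`, from which `S_κ`
strips the factor `κ`. -/
theorem algInv_mul_embed_projector (hk : FirstLevelKernels κ k₁ k₂) (f : ℝ → 𝕜) :
    hk.algInv * hk.embed (projector κ k₁ k₂ f) (hk.mem_projector f) =
      initialValue k₂ f • hk.embed k₁ hk.mem_k₁ := by
  rw [← hk.embed_smul, ← hk.algInv_mul_embed_lconv (hk.mem_k₁.smul _)]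
  congr 1
  exact hk.embed_congr _ _ fun t _ => (lconv_smul _ κ k₁ t).symm

theorem embed_gfd (hk : FirstLevelKernels κ k₁ k₂) {f : ℝ → 𝕜} (hf : MemC1 k₂ f)
    (hD : MemCm1 (gfd k₁ k₂ f)) : hk.embed (gfd k₁ k₂ f) hD = hk.agfd f hf.mem := by
  have hP := hk.mem_projector f
  -- The derivative `D₁ = gfd k₁ k₂ f` is rewritten as `S_κ · (κ * D₁)`, so that `S_κ` factors out
  -- and the claim reduces to `P f + κ * D₁ = f` under the embedding.
  rw [agfd, eq_sub_iff_add_eq, ← hk.algInv_mul_embed_lconv hD, ← mul_add, add_comm,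
    ← hk.embed_add hP (hk.mem_κ.lconv hD)]
  congr 1
  -- The identity is available only for `t > 0`, which suffices because the embedding discards all
  -- other values.
  exact hk.embed_congr _ _ fun t ht => (hk.eq_projector_add hf ht).symm

end FirstLevelKernels

end GFDCalculus

/-- The second conjunct certifies that `initialValue` is a genuine limit. The existential over `hD`
asserts that the derivative lies in `C₋₁`, without which its embedding into the field would not be
defined. -/
theorem theorem4p1 {𝕜 : Type*} [RCLike 𝕜] {κ k₁ k₂ : ℝ → 𝕜} (hk : FirstLevelKernels κ k₁ k₂)
    (f : ℝ → 𝕜) (hf : MemC1 k₂ f) :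
    (∀ t : ℝ, 0 < t → GFDExistsAt k₁ k₂ f t) ∧
    Tendsto (gfi k₂ f) (𝓝[>] 0) (𝓝 (initialValue k₂ f)) ∧
    (∀ t : ℝ, 0 < t → projector κ k₁ k₂ f t = f t - gfi κ (gfd k₁ k₂ f) t) ∧
    ∃ hD : MemCm1 (gfd k₁ k₂ f),
      hk.embed (gfd k₁ k₂ f) hD = hk.agfd f hf.mem ∧
      hk.agfd f hf.mem =
        hk.algInv * hk.embed f hf.mem - initialValue k₂ f • hk.embed k₁ hk.mem_k₁ := by
  have hD : MemCm1 (gfd k₁ k₂ f) := hk.mem_k₁.lconv hf.mem_rlGFD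
  refine ⟨fun t ht => hf.gfdExistsAt hk.mem_k₁ hk.mem_k₂ ht, hf.tendsto_initialValue,
    fun t ht => eq_sub_of_add_eq (hk.eq_projector_add hf ht).symm, hD, hk.embed_gfd hf hD, ?_⟩
  rw [FirstLevelKernels.agfd, hk.algInv_mul_embed_projector]
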